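/- **Proposition.** Let $N\ge 1$, let $\alpha>0$ and $\omega>0$ be real numbers with $\frac{\omega}{\alpha}<\frac12$, and let $(a,b)$ be the unique pair of real numbers with $$a^2+b^2=1,\qquad ab=\frac{\omega}{\alpha},\qquad 0<a<b.$$ Let $u,v:\mathbb{R}^N\to(0,\infty)$ be functions of class $C^2$ which satisfy, at every point of $\mathbb{R}^N$, $$\Delta u=-u(1-u^2-v^2)-v(\omega-\alpha uv),\qquad \Delta v=-v(1-u^2-v^2)-u(\omega-\alpha uv).$$ (No condition at infinity is imposed.) Then $$u^2+v^2\le 1\quad\text{and}\quad uv\ge\frac{\omega}{\alpha}\qquad\text{everywhere in }\mathbb{R}^N.$$ Moreover, either $(u,v)\equiv(a,b)$, or $(u,v)\equiv(b,a)$, or $a<u(x)<b$ and $a<v(x)<b$ for every $x\in\mathbb{R}^N$. -/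

import Mathlib

/-- `(u, v)` is a positive regular (that is, twice continuously differentiable, classical) solution
on the whole space `ℝᴺ` of the coupled system
`Δu = -u(1 - u² - v²) - v(ω - αuv)`, `Δv = -v(1 - u² - v²) - u(ω - αuv)`.
No condition at infinity is imposed. -/
structure IsPositiveRegularSolution {N : ℕ} (α ω : ℝ) (u v : EuclideanSpace ℝ (Fin N) → ℝ) :
    Prop where
  contDiff_u : ContDiff ℝ 2 u
  contDiff_v : ContDiff ℝ 2 v
  pos_u : ∀ x, 0 < u x
  pos_v : ∀ x, 0 < v x
  eq_u : ∀ x, Laplacian.laplacian u x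
    = -(u x) * (1 - u x ^ 2 - v x ^ 2) - v x * (ω - α * u x * v x)
  eq_v : ∀ x, Laplacian.laplacian v x
    = -(v x) * (1 - u x ^ 2 - v x ^ 2) - u x * (ω - α * u x * v x)

/-- `(a, b)` solves the algebraic system `a² + b² = 1`, `ab = ω/α`, `0 < a < b`
(which has exactly one solution when `0 < ω/α < 1/2`). -/
structure IsConstantState (α ω a b : ℝ) : Prop where
  sq_add_sq : a ^ 2 + b ^ 2 = 1
  mul_eq : a * b = ω / α
  pos : 0 < a
  lt : a < b

/-! Put `S = u² + v²` and `P = uv`. The system gives `ΔS = 2|∇u|² + 2|∇v|² + 2S(S - 1) - 4P(ω - αP)`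
and `ΔP ≤ -2P(1 - S) - S(ω - αP) + |∇P|²/(2P)`. With no condition at infinity, localized maximum
arguments first bound `S` above (`sq_add_sq_le`) and `P` away from zero (`le_mul`). So `M = sup S`
and `m = inf P > 0` are finite, and the two relations can be evaluated at almost extremal points
(`exists_almost_max`). With `D = ω - αm`, they yield `M(M - 1) ≤ 2(ω/α) max(D, 0)` and, if `D > 0`,
also `D ≤ M - 1`. As `2ω/α < 1`, these exclude `D > 0`; hence `m ≥ ω/α`, and then `M ≤ 1`. If `S`
equals `1` somewhere, the strong minimum principle for `1 - S` gives `S ≡ 1`, and `ΔS = 0` kills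
both gradients. Otherwise `S < 1` everywhere, and the strict bounds are algebra at each point. -/

/-! ### Second-order calculus in one variable. -/

/-- `f` is differentiable near `0`, with first and second derivatives `a`, `b` at `0`. -/
def HasSecondDeriv (f : ℝ → ℝ) (a b : ℝ) : Prop :=
  ∃ f' : ℝ → ℝ, (∀ᶠ t in nhds 0, HasDerivAt f (f' t) t) ∧ f' 0 = a ∧ HasDerivAt f' b 0

namespace HasSecondDeriv

variable {f g : ℝ → ℝ} {a b c d : ℝ}

theorem hasDerivAt (hf : HasSecondDeriv f a b) : HasDerivAt f a 0 := by
  obtain ⟨f', h1, rfl, -⟩ := hf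
  exact h1.self_of_nhds

theorem const (r : ℝ) : HasSecondDeriv (fun _ => r) 0 0 :=
  ⟨fun _ => 0, Filter.Eventually.of_forall fun t => hasDerivAt_const t r, rfl,
    hasDerivAt_const 0 0⟩

theorem add (hf : HasSecondDeriv f a b) (hg : HasSecondDeriv g c d) :
    HasSecondDeriv (fun t => f t + g t) (a + c) (b + d) := by
  obtain ⟨f', h1, rfl, h2⟩ := hf
  obtain ⟨g', k1, rfl, k2⟩ := hg
  exact ⟨fun t => f' t + g' t, by filter_upwards [h1, k1] with t h k using h.add k, rfl, h2.add k2⟩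

theorem mul (hf : HasSecondDeriv f a b) (hg : HasSecondDeriv g c d) :
    HasSecondDeriv (fun t => f t * g t) (a * g 0 + f 0 * c) (b * g 0 + 2 * a * c + f 0 * d) := by
  have hf0 := hf.hasDerivAt
  have hg0 := hg.hasDerivAt
  obtain ⟨f', h1, rfl, h2⟩ := hf
  obtain ⟨g', k1, rfl, k2⟩ := hg
  refine ⟨fun t => f' t * g t + f t * g' t,
    by filter_upwards [h1, k1] with t h k using h.mul k, rfl, ?_⟩
  exact ((h2.mul hg0).add (hf0.mul k2)).congr_deriv (by ring)

theorem exp (hf : HasSecondDeriv f a b) :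
    HasSecondDeriv (fun t => Real.exp (f t)) (Real.exp (f 0) * a)
      (Real.exp (f 0) * (a ^ 2 + b)) := by
  have hf0 := hf.hasDerivAt
  obtain ⟨f', h1, rfl, h2⟩ := hf
  refine ⟨fun t => Real.exp (f t) * f' t,
    by filter_upwards [h1] with t h using h.exp, rfl, ?_⟩
  exact (hf0.exp.mul h2).congr_deriv (by ring)

theorem quadratic (p q r : ℝ) : HasSecondDeriv (fun t => p + q * t + r * t ^ 2) q (2 * r) := by
  refine ⟨fun t => q + 2 * r * t, Filter.Eventually.of_forall fun t => ?_, by simp, ?_⟩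
  · have := (((hasDerivAt_id t).const_mul q).const_add p).add (((hasDerivAt_id t).pow 2).const_mul r)
    exact this.congr_deriv (by simp; ring)
  · simpa using ((hasDerivAt_id (0 : ℝ)).const_mul (2 * r)).const_add q

/-- If `b > 0`, the second derivative test makes `0` a local minimum too; then `f` is constant near
`0`, so `b = 0`. -/
theorem nonpos_of_isLocalMax (hf : HasSecondDeriv f a b) (hm : IsLocalMax f 0) :
    a = 0 ∧ b ≤ 0 := by
  have ha : a = 0 := hm.hasDerivAt_eq_zero hf.hasDerivAt
  refine ⟨ha, ?_⟩
  have hf0 := hf.hasDerivAt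
  obtain ⟨f', h1, h0, h2⟩ := hf
  by_contra! hb
  have hd : deriv f =ᶠ[nhds 0] f' := by filter_upwards [h1] with t h using h.deriv
  have hdd : deriv (deriv f) 0 = b := by rw [hd.deriv_eq, h2.deriv]
  have hmin := isLocalMin_of_deriv_deriv_pos (by rw [hdd]; exact hb)
    (by rw [hf0.deriv, ha]) hf0.continuousAt
  have hc : f =ᶠ[nhds 0] fun _ => f 0 := by
    filter_upwards [hm, hmin] with t h k using le_antisymm h k
  have : deriv (deriv f) 0 = 0 := by
    rw [hc.deriv.deriv_eq]; simp
  linarith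

end HasSecondDeriv

/-! ### Derivatives along coordinate lines. -/

/-- The first and second partial derivatives of `f` at `x`, pure ones only, are `g` and `h`. -/
def HasJet {N : ℕ} (f : EuclideanSpace ℝ (Fin N) → ℝ) (x : EuclideanSpace ℝ (Fin N))
    (g h : Fin N → ℝ) : Prop :=
  ∀ i, HasSecondDeriv (fun t => f (x + t • EuclideanSpace.single i (1 : ℝ))) (g i) (h i)

namespace HasJet

variable {N : ℕ} {f f₂ : EuclideanSpace ℝ (Fin N) → ℝ} {x : EuclideanSpace ℝ (Fin N)}
  {g h g₂ h₂ : Fin N → ℝ}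

theorem const (r : ℝ) : HasJet (fun _ => r) x (fun _ => 0) (fun _ => 0) :=
  fun _ => HasSecondDeriv.const r

theorem add (hf : HasJet f x g h) (hf₂ : HasJet f₂ x g₂ h₂) :
    HasJet (fun y => f y + f₂ y) x (fun i => g i + g₂ i) (fun i => h i + h₂ i) :=
  fun i => (hf i).add (hf₂ i)

theorem mul (hf : HasJet f x g h) (hf₂ : HasJet f₂ x g₂ h₂) :
    HasJet (fun y => f y * f₂ y) x (fun i => g i * f₂ x + f x * g₂ i)
      (fun i => h i * f₂ x + 2 * g i * g₂ i + f x * h₂ i) :=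
  fun i => by simpa using (hf i).mul (hf₂ i)

theorem congr_jet (hf : HasJet f x g h) (hg : ∀ i, g₂ i = g i) (hh : ∀ i, h₂ i = h i) :
    HasJet f x g₂ h₂ := by
  rwa [funext hg, funext hh]

theorem const_mul (r : ℝ) (hf : HasJet f x g h) :
    HasJet (fun y => r * f y) x (fun i => r * g i) (fun i => r * h i) :=
  ((const r).mul hf).congr_jet (fun i => by ring) (fun i => by ring)

theorem sub (hf : HasJet f x g h) (hf₂ : HasJet f₂ x g₂ h₂) :
    HasJet (fun y => f y - f₂ y) x (fun i => g i - g₂ i) (fun i => h i - h₂ i) := by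
  have := (hf.add (hf₂.const_mul (-1))).congr_jet (g₂ := fun i => g i - g₂ i)
    (h₂ := fun i => h i - h₂ i) (fun i => by ring) (fun i => by ring)
  simpa [sub_eq_add_neg] using this

theorem sq (hf : HasJet f x g h) :
    HasJet (fun y => f y ^ 2) x (fun i => 2 * f x * g i)
      (fun i => 2 * g i ^ 2 + 2 * f x * h i) := by
  have := (hf.mul hf).congr_jet (g₂ := fun i => 2 * f x * g i)
    (h₂ := fun i => 2 * g i ^ 2 + 2 * f x * h i) (fun i => by ring) (fun i => by ring)
  simpa [pow_two] using this

theorem exp (hf : HasJet f x g h) :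
    HasJet (fun y => Real.exp (f y)) x (fun i => Real.exp (f x) * g i)
      (fun i => Real.exp (f x) * (g i ^ 2 + h i)) :=
  fun i => by simpa using (hf i).exp

theorem norm_sub_sq (x y : EuclideanSpace ℝ (Fin N)) :
    HasJet (fun z => ‖z - y‖ ^ 2) x (fun i => 2 * (x - y) i) (fun _ => 2) := by
  intro i
  have h := HasSecondDeriv.quadratic (‖x - y‖ ^ 2) (2 * (x - y) i) 1
  have e : (fun t : ℝ => ‖x + t • EuclideanSpace.single i (1 : ℝ) - y‖ ^ 2) =
      fun t => ‖x - y‖ ^ 2 + 2 * (x - y) i * t + 1 * t ^ 2 := by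
    funext t
    rw [add_sub_right_comm, norm_add_sq_real, norm_smul, inner_smul_right,
      EuclideanSpace.inner_single_right]
    simp
    ring
  rw [e]
  simpa using h

theorem nonpos_of_isLocalMax (hf : HasJet f x g h) (hm : IsLocalMax f x) (i : Fin N) :
    g i = 0 ∧ h i ≤ 0 := by
  refine (hf i).nonpos_of_isLocalMax ?_
  have hc : ContinuousAt (fun t : ℝ => x + t • EuclideanSpace.single i (1 : ℝ)) 0 := by fun_prop
  have : Filter.Tendsto (fun t : ℝ => x + t • EuclideanSpace.single i (1 : ℝ)) (nhds 0)
      (nhds x) := by simpa using hc.tendsto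
  have h2 := this.eventually hm
  filter_upwards [h2] with t ht
  simpa using ht

theorem of_contDiff (hf : ContDiff ℝ 2 f) (x : EuclideanSpace ℝ (Fin N)) :
    HasJet f x (fun i => fderiv ℝ f x (EuclideanSpace.single i 1))
      (fun i => fderiv ℝ (fderiv ℝ f) x (EuclideanSpace.single i 1)
        (EuclideanSpace.single i 1)) := by
  intro i
  set e := EuclideanSpace.single i (1 : ℝ)
  have hl (t : ℝ) : HasDerivAt (fun t : ℝ => x + t • e) e t := by
    simpa using ((hasDerivAt_id t).smul_const e).const_add x
  have h1 : Differentiable ℝ f := hf.differentiable (by norm_num)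
  have h2 : Differentiable ℝ (fderiv ℝ f) :=
    (hf.fderiv_right (m := 1) (by norm_num)).differentiable (by norm_num)
  refine ⟨fun t => fderiv ℝ f (x + t • e) e, Filter.Eventually.of_forall fun t => ?_,
    by simp [e], ?_⟩
  · exact (h1 (x + t • e)).hasFDerivAt.comp_hasDerivAt t (hl t)
  · have h3 : HasFDerivAt (fderiv ℝ f) (fderiv ℝ (fderiv ℝ f) x) (x + (0 : ℝ) • e) := by
      simpa using (h2 x).hasFDerivAt
    have h4 := h3.comp_hasDerivAt (0 : ℝ) (hl 0)
    simpa using h4.clm_apply (hasDerivAt_const (0 : ℝ) e)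

theorem sum_fderiv_fderiv_eq_laplacian (f : EuclideanSpace ℝ (Fin N) → ℝ)
    (x : EuclideanSpace ℝ (Fin N)) :
    ∑ i, fderiv ℝ (fderiv ℝ f) x (EuclideanSpace.single i 1) (EuclideanSpace.single i 1) =
      Laplacian.laplacian f x := by
  rw [InnerProductSpace.laplacian_eq_iteratedFDeriv_orthonormalBasis f
    (EuclideanSpace.basisFun (Fin N) ℝ)]
  simp [iteratedFDeriv_two_apply]

end HasJet

theorem EuclideanSpace.sum_sq_eq_norm_sq {N : ℕ} (x : EuclideanSpace ℝ (Fin N)) :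
    ∑ i, x i ^ 2 = ‖x‖ ^ 2 := by
  rw [EuclideanSpace.norm_sq_eq]; simp

/-! ### Maximum principles. -/

section MaximumPrinciple

variable {N : ℕ} {f : EuclideanSpace ℝ (Fin N) → ℝ}

/-- A continuous function that exceeds its values on a sphere at some point inside has an interior
maximum on the ball. -/
theorem exists_isLocalMax_of_lt_sphere (hf : Continuous f) {y x₁ : EuclideanSpace ℝ (Fin N)}
    {R : ℝ} (hx₁ : ‖x₁ - y‖ ≤ R) (hs : ∀ x, ‖x - y‖ = R → f x < f x₁) :
    ∃ x₀, ‖x₀ - y‖ < R ∧ IsLocalMax f x₀ ∧ ∀ x, ‖x - y‖ ≤ R → f x ≤ f x₀ := by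
  obtain ⟨x₀, h0, hmax⟩ := (isCompact_closedBall y R).exists_isMaxOn
    ⟨x₁, by simpa [dist_eq_norm] using hx₁⟩ hf.continuousOn
  have hmax' : ∀ x, ‖x - y‖ ≤ R → f x ≤ f x₀ := fun x hx =>
    hmax (by simpa [dist_eq_norm] using hx)
  have h0' : ‖x₀ - y‖ ≤ R := by simpa [dist_eq_norm] using h0
  have hlt : ‖x₀ - y‖ < R := lt_of_le_of_ne h0' fun h => by
    have := hs x₀ h
    have := hmax' x₁ hx₁
    linarith
  refine ⟨x₀, hlt, ?_, hmax'⟩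
  exact hmax.isLocalMax (Metric.closedBall_mem_nhds_of_mem (by simpa [dist_eq_norm] using hlt))

/-- A function bounded above has almost maximum points with almost vanishing gradient and almost
nonpositive Laplacian. -/
theorem exists_almost_max (hf : Continuous f) {M η : ℝ} (hM : ∀ x, f x ≤ M) (hη : 0 < η)
    {y : EuclideanSpace ℝ (Fin N)} (hy : M - η < f y) :
    ∃ x, M - η < f x ∧ ∀ g h, HasJet f x g h →
      ∑ i, g i ^ 2 ≤ 4 * η ^ 2 ∧ ∑ i, h i ≤ 2 * N * η := by
  -- On the unit sphere about `y` the penalty leaves at most `M - η < f y`, so the maximum is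
  -- interior; there the gradient of `f` is `2η(x - y)` and each pure second derivative is at most
  -- `2η`.
  have hc : Continuous fun x => f x - η * ‖x - y‖ ^ 2 := by fun_prop
  obtain ⟨x, hx, hmax, hle⟩ := exists_isLocalMax_of_lt_sphere hc (y := y) (x₁ := y) (R := 1)
    (by simp) (by
      intro x hx
      have := hM x
      simp only [hx, sub_self, norm_zero]
      linarith)
  have h1 := hle y (by simp)
  simp only [sub_self, norm_zero] at h1
  have hnn : 0 ≤ η * ‖x - y‖ ^ 2 := by positivity
  refine ⟨x, by linarith, fun g h hj => ?_⟩
  have hj2 := hj.sub ((HasJet.norm_sub_sq x y).const_mul η)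
  have key := hj2.nonpos_of_isLocalMax hmax
  constructor
  · have e : ∀ i, g i ^ 2 = 4 * η ^ 2 * (x - y) i ^ 2 := fun i => by
      have : g i = η * (2 * (x - y) i) := by linarith [(key i).1]
      rw [this]; ring
    simp_rw [e]
    rw [← Finset.mul_sum, EuclideanSpace.sum_sq_eq_norm_sq]
    have : ‖x - y‖ ^ 2 ≤ 1 := by
      have := norm_nonneg (x - y)
      nlinarith
    nlinarith [sq_nonneg η]
  · calc ∑ i, h i ≤ ∑ _i : Fin N, 2 * η := Finset.sum_le_sum fun i _ => by linarith [(key i).2]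
      _ = 2 * N * η := by simp; ring

end MaximumPrinciple

/-- Strong minimum principle: a nonnegative function with `Δs ≤ C s` that vanishes somewhere
vanishes everywhere. -/
theorem eq_zero_of_laplacian_le {N : ℕ} {s : EuclideanSpace ℝ (Fin N) → ℝ} (hs : Continuous s)
    {C : ℝ} (hC : 0 < C) (hnn : ∀ x, 0 ≤ s x)
    (hΔ : ∀ x, ∃ g h, HasJet s x g h ∧ ∑ i, h i ≤ C * s x)
    {x₀ : EuclideanSpace ℝ (Fin N)} (h0 : s x₀ = 0) (y : EuclideanSpace ℝ (Fin N)) : s y = 0 := by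
  by_contra hne
  have hy : 0 < s y := lt_of_le_of_ne (hnn y) (Ne.symm hne)
  set m := s y / 2 with hm
  have hmpos : 0 < m := by positivity
  obtain ⟨ρ, hρ, hball⟩ : ∃ ρ > 0, ∀ x, ‖x - y‖ < ρ → m < s x := by
    have : ∀ᶠ x in nhds y, m < s x := hs.continuousAt.eventually (lt_mem_nhds (by linarith))
    obtain ⟨ρ, hρ, h⟩ := Metric.eventually_nhds_iff.mp this
    exact ⟨ρ, hρ, fun x hx => h (by simpa [dist_eq_norm] using hx)⟩
  set R := ‖x₀ - y‖ + 1 with hR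
  -- Chosen so that `4k²r² - 2kN ≥ C` for `r ≥ ρ`: the Gaussian barrier below then satisfies `ΔB ≥ C
  -- m exp(-kr²)` outside the `ρ`-ball.
  set k := 1 + (N + C) / ρ ^ 2 with hk
  have hk1 : 1 ≤ k := by rw [hk]; linarith [show (0 : ℝ) ≤ (N + C) / ρ ^ 2 by positivity]
  have hkρ : N + C ≤ k * ρ ^ 2 := by
    rw [hk, add_mul, div_mul_cancel₀ _ (by positivity)]
    nlinarith [sq_nonneg ρ]
  have hc : Continuous fun x =>
      m * (Real.exp (-k * ‖x - y‖ ^ 2) - Real.exp (-k * R ^ 2)) - s x := by fun_prop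
  have hfx₀ : 0 < m * (Real.exp (-k * ‖x₀ - y‖ ^ 2) - Real.exp (-k * R ^ 2)) - s x₀ := by
    rw [h0, sub_zero]
    refine mul_pos hmpos (sub_pos.mpr (Real.exp_lt_exp.mpr ?_))
    have := norm_nonneg (x₀ - y)
    rw [hR]
    nlinarith
  obtain ⟨z, -, hmax, hle⟩ := exists_isLocalMax_of_lt_sphere hc (y := y) (x₁ := x₀) (R := R)
    (by rw [hR]; linarith) (by
      intro x hx
      refine lt_of_le_of_lt ?_ hfx₀
      simp only [hx, sub_self, mul_zero, zero_sub]
      linarith [hnn x])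
  have hz := lt_of_lt_of_le hfx₀ (hle x₀ (by rw [hR]; linarith))
  have hE : 0 < Real.exp (-k * ‖z - y‖ ^ 2) := Real.exp_pos _
  have hE1 : Real.exp (-k * ‖z - y‖ ^ 2) ≤ 1 := Real.exp_le_one_iff.mpr (by
    nlinarith [sq_nonneg ‖z - y‖])
  have hER : 0 < Real.exp (-k * R ^ 2) := Real.exp_pos _
  -- Inside the `ρ`-ball `s > m` exceeds the barrier, whereas the barrier exceeds `s` at `z`.
  have hρz : ρ ≤ ‖z - y‖ := by
    by_contra! hlt
    have := hball z hlt
    nlinarith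
  obtain ⟨g, h, hj, hsum⟩ := hΔ z
  have hjet := (((HasJet.norm_sub_sq z y).const_mul (-k)).exp.sub
    (HasJet.const (Real.exp (-k * R ^ 2)))).const_mul m |>.sub hj
  set E := Real.exp (-k * ‖z - y‖ ^ 2) with hEdef
  have key : m * (E * (4 * k ^ 2 * ‖z - y‖ ^ 2 - 2 * k * N)) ≤ ∑ i, h i := by
    calc m * (E * (4 * k ^ 2 * ‖z - y‖ ^ 2 - 2 * k * N))
        = ∑ i, m * (E * ((-k * (2 * (z - y) i)) ^ 2 + -k * 2) - 0) := by
          rw [← EuclideanSpace.sum_sq_eq_norm_sq]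
          simp only [mul_pow, sub_zero, ← Finset.mul_sum, Finset.sum_add_distrib, Finset.sum_const,
            Finset.card_univ, Fintype.card_fin, nsmul_eq_mul]
          ring
      _ ≤ ∑ i, h i := Finset.sum_le_sum fun i _ => by
          linarith [(hjet.nonpos_of_isLocalMax hmax i).2]
  have h2 : ρ ^ 2 ≤ ‖z - y‖ ^ 2 := pow_le_pow_left₀ hρ.le hρz 2
  have h3 : C ≤ 4 * k ^ 2 * ‖z - y‖ ^ 2 - 2 * k * N := by
    have h4 : N + C ≤ k * ‖z - y‖ ^ 2 := hkρ.trans (by gcongr)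
    have h5 : k * (N + C) ≤ k * (k * ‖z - y‖ ^ 2) := by gcongr
    have h6 : C ≤ k * C := by nlinarith
    have : (0 : ℝ) ≤ k * N := by positivity
    nlinarith
  have h4 : m * (E * C) ≤ m * (E * (4 * k ^ 2 * ‖z - y‖ ^ 2 - 2 * k * N)) := by gcongr
  have h5 : C * s z < C * (m * E) := by
    refine mul_lt_mul_of_pos_left ?_ hC
    nlinarith
  linarith [mul_comm C (m * E), mul_assoc m E C]

/-! ### A priori bounds. -/

namespace IsPositiveRegularSolution

variable {N : ℕ} {α ω : ℝ} {u v : EuclideanSpace ℝ (Fin N) → ℝ}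

theorem two_mul_le_sq_add_sq (x : EuclideanSpace ℝ (Fin N)) :
    2 * (u x * v x) ≤ u x ^ 2 + v x ^ 2 := by
  nlinarith [sq_nonneg (u x - v x)]

theorem continuous_u (huv : IsPositiveRegularSolution α ω u v) : Continuous u :=
  huv.contDiff_u.continuous

theorem continuous_v (huv : IsPositiveRegularSolution α ω u v) : Continuous v :=
  huv.contDiff_v.continuous

theorem hasJet_sq_add_sq (huv : IsPositiveRegularSolution α ω u v)
    (x : EuclideanSpace ℝ (Fin N)) :
    ∃ g h, HasJet (fun y => u y ^ 2 + v y ^ 2) x g h ∧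
      ∑ i, h i = 2 * ∑ i, (fderiv ℝ u x (EuclideanSpace.single i 1) ^ 2 +
          fderiv ℝ v x (EuclideanSpace.single i 1) ^ 2) +
        2 * (u x ^ 2 + v x ^ 2) * (u x ^ 2 + v x ^ 2 - 1) -
        4 * (u x * v x) * (ω - α * (u x * v x)) := by
  refine ⟨_, _, (HasJet.of_contDiff huv.contDiff_u x).sq.add
    (HasJet.of_contDiff huv.contDiff_v x).sq, ?_⟩
  have hu := (HasJet.sum_fderiv_fderiv_eq_laplacian u x).trans (huv.eq_u x)
  have hv := (HasJet.sum_fderiv_fderiv_eq_laplacian v x).trans (huv.eq_v x)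
  simp only [Finset.sum_add_distrib, ← Finset.mul_sum]
  rw [hu, hv]
  ring

/-- The cross term `2∇u·∇v` has no sign, but `|v∇u - u∇v|² ≥ 0` bounds it by `|∇P|²/(2P)`, which is
small at almost minima of `P`. -/
theorem hasJet_mul (huv : IsPositiveRegularSolution α ω u v) (x : EuclideanSpace ℝ (Fin N)) :
    ∃ g h, HasJet (fun y => u y * v y) x g h ∧
      ∑ i, h i ≤ -2 * (u x * v x) * (1 - (u x ^ 2 + v x ^ 2)) -
        (u x ^ 2 + v x ^ 2) * (ω - α * (u x * v x)) + (∑ i, g i ^ 2) / (2 * (u x * v x)) := by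
  refine ⟨_, _, (HasJet.of_contDiff huv.contDiff_u x).mul
    (HasJet.of_contDiff huv.contDiff_v x), ?_⟩
  have hu := (HasJet.sum_fderiv_fderiv_eq_laplacian u x).trans (huv.eq_u x)
  have hv := (HasJet.sum_fderiv_fderiv_eq_laplacian v x).trans (huv.eq_v x)
  have hpu := huv.pos_u x
  have hpv := huv.pos_v x
  have hcross : ∑ i, 2 * fderiv ℝ u x (EuclideanSpace.single i 1) *
      fderiv ℝ v x (EuclideanSpace.single i 1) ≤
      (∑ i, (fderiv ℝ u x (EuclideanSpace.single i 1) * v x +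
        u x * fderiv ℝ v x (EuclideanSpace.single i 1)) ^ 2) / (2 * (u x * v x)) := by
    rw [Finset.sum_div]
    refine Finset.sum_le_sum fun i _ => ?_
    rw [le_div_iff₀ (by positivity)]
    nlinarith [sq_nonneg (fderiv ℝ u x (EuclideanSpace.single i 1) * v x -
        u x * fderiv ℝ v x (EuclideanSpace.single i 1))]
  simp only [Finset.sum_add_distrib, ← Finset.mul_sum, ← Finset.sum_mul] at hcross ⊢
  rw [hu, hv]
  simp only [mul_assoc, ← Finset.mul_sum] at hcross ⊢
  nlinarith

/-- A Keller–Osserman bound. -/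
theorem sq_add_sq_le (huv : IsPositiveRegularSolution α ω u v) (hα : 0 < α)
    (y : EuclideanSpace ℝ (Fin N)) : u y ^ 2 + v y ^ 2 ≤ 14 + 2 * N + ω ^ 2 / α := by
  have hS : ∀ x, 0 < u x ^ 2 + v x ^ 2 := fun x => by have := huv.pos_u x; positivity
  have hcu := huv.continuous_u
  have hcv := huv.continuous_v
  -- The cutoff vanishes on the unit sphere and forces an interior maximum; its derivatives cost
  -- only `O(S)`, which the `2S²` in `ΔS` absorbs.
  have hc : Continuous fun x => (u x ^ 2 + v x ^ 2) * (1 - ‖x - y‖ ^ 2) ^ 2 := by fun_prop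
  obtain ⟨z, hz, hmax, hle⟩ := exists_isLocalMax_of_lt_sphere hc (y := y) (x₁ := y) (R := 1)
    (by simp) (by
      intro x hx
      simp only [hx, sub_self, norm_zero]
      simpa using hS y)
  have hTy := hle y (by simp)
  simp only [sub_self, norm_zero] at hTy
  obtain ⟨g, h, hj, hsum⟩ := huv.hasJet_sq_add_sq z
  have key := (hj.mul (((HasJet.const 1).sub (HasJet.norm_sub_sq z y)).sq)).nonpos_of_isLocalMax
    hmax
  have hgrad : 0 ≤ ∑ i, (fderiv ℝ u z (EuclideanSpace.single i 1) ^ 2 +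
          fderiv ℝ v z (EuclideanSpace.single i 1) ^ 2) :=
    Finset.sum_nonneg fun i _ => by positivity
  have hSz := hS z
  set S := u z ^ 2 + v z ^ 2
  set P := u z * v z
  set ρ := 1 - ‖z - y‖ ^ 2 with hρdef
  have hr := norm_nonneg (z - y)
  have hρ : 0 < ρ := by rw [hρdef]; nlinarith
  have hρ1 : ρ ≤ 1 := by rw [hρdef]; nlinarith
  have hi : ∀ i, h i * ρ ^ 2 ≤ 24 * S * (z - y) i ^ 2 + 4 * S * ρ := fun i => by
    obtain ⟨h1, h2⟩ := key i
    have h3 : g i * ρ = 4 * S * (z - y) i := by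
      have : ρ * (g i * ρ - 4 * S * (z - y) i) = 0 := by linarith
      rcases mul_eq_zero.mp this with h | h
      · exact absurd h hρ.ne'
      · linarith
    have h4 : 2 * g i * (2 * ρ * (0 - 2 * (z - y) i)) = -32 * S * (z - y) i ^ 2 := by
      linear_combination (-8 * (z - y) i) * h3
    linarith
  have hsum2 : (∑ i, h i) * ρ ^ 2 ≤ 24 * S * ‖z - y‖ ^ 2 + N * (4 * S * ρ) := by
    rw [Finset.sum_mul]
    refine (Finset.sum_le_sum fun i _ => hi i).trans (le_of_eq ?_)
    rw [Finset.sum_add_distrib, ← Finset.mul_sum, EuclideanSpace.sum_sq_eq_norm_sq]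
    simp
  have hP : -(ω ^ 2 / α) ≤ -4 * P * (ω - α * P) := by
    rw [← neg_div, div_le_iff₀ hα]
    nlinarith [sq_nonneg (2 * α * P - ω)]
  have hlow : 2 * S * (S - 1) - ω ^ 2 / α ≤ ∑ i, h i := by rw [hsum]; linarith
  set c := ω ^ 2 / α with hcdef
  have hc0 : 0 ≤ c := by positivity
  have h1 : (2 * S * (S - 1) - c) * ρ ^ 2 ≤ (24 + 4 * N) * S := by
    have ha : (2 * S * (S - 1) - c) * ρ ^ 2 ≤ (∑ i, h i) * ρ ^ 2 := by gcongr
    have hb : ‖z - y‖ ^ 2 ≤ 1 := by nlinarith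
    have hd : 24 * S * ‖z - y‖ ^ 2 ≤ 24 * S * 1 := by gcongr
    have he : (N : ℝ) * (4 * S * ρ) ≤ N * (4 * S * 1) := by gcongr
    linarith
  have hρ2 : ρ ^ 2 ≤ 1 := by nlinarith
  -- A second factor `ρ²` makes this a quadratic inequality in `T = Sρ²` alone.
  have h2 : (2 * S * (S - 1) - c) * ρ ^ 2 * ρ ^ 2 ≤ (24 + 4 * N) * S * ρ ^ 2 := by gcongr
  have hT0 : 0 < S * ρ ^ 2 := by positivity
  have h3 : 2 * (S * ρ ^ 2) ^ 2 ≤ (26 + 4 * N) * (S * ρ ^ 2) + c := by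
    have ha : (S * ρ ^ 2) * ρ ^ 2 ≤ (S * ρ ^ 2) * 1 := by gcongr
    have hb : c * (ρ ^ 2 * ρ ^ 2) ≤ c * (1 * 1) := by gcongr
    linarith
  by_contra! hlt
  have hT : 14 + 2 * N + c < S * ρ ^ 2 := by linarith
  have hN : (0 : ℝ) ≤ N := by positivity
  nlinarith

/-- The product `u v` is bounded away from zero. -/
theorem le_mul (huv : IsPositiveRegularSolution α ω u v) (hα : 0 < α) (hω : 0 < ω)
    (y : EuclideanSpace ℝ (Fin N)) : ω / (2 * (2 + α)) ≤ u y * v y := by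
  by_contra! hlt
  have hP : ∀ x, 0 < u x * v x := fun x => mul_pos (huv.pos_u x) (huv.pos_v x)
  have hcu := huv.continuous_u
  have hcv := huv.continuous_v
  -- With this radius the final inequality reads `(ρ - R)² + 7R² ≤ 0`.
  set R : ℝ := 2 * N + 4 with hR
  have hRpos : 0 < R := by positivity
  -- With the fourth power, the Hessian of the cutoff contributes `48ρ²r²`, more than the `32ρ²r²`
  -- coming from `|∇P|²/(2P)`.
  have hc : Continuous fun x => ((R ^ 2 - ‖x - y‖ ^ 2) ^ 2) ^ 2 / (u x * v x) :=
    Continuous.div (by fun_prop) (by fun_prop) fun x => (hP x).ne'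
  obtain ⟨z, hz, -, hle⟩ := exists_isLocalMax_of_lt_sphere hc (y := y) (x₁ := y) (R := R)
    (by simpa using hRpos.le) (by
      intro x hx
      simp only [hx, sub_self, norm_zero]
      have := hP y
      simp only [ne_eq, OfNat.ofNat_ne_zero, not_false_eq_true, zero_pow, zero_div, sub_zero]
      positivity)
  have hFy := hle y (by simpa using hRpos.le)
  simp only [sub_self, norm_zero] at hFy
  set ρ := R ^ 2 - ‖z - y‖ ^ 2 with hρdef
  have hr := norm_nonneg (z - y)
  have hρ : 0 < ρ := by rw [hρdef]; nlinarith
  have hρR : ρ ≤ R ^ 2 := by rw [hρdef]; nlinarith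
  set M := (ρ ^ 2) ^ 2 / (u z * v z) with hM
  have hPz := hP z
  have hMpos : 0 < M := by positivity
  have hMP : M * (u z * v z) = (ρ ^ 2) ^ 2 := div_mul_cancel₀ _ hPz.ne'
  have hPzlt : u z * v z < ω / (2 * (2 + α)) := by
    refine lt_of_le_of_lt ?_ hlt
    rw [div_le_iff₀ (hP y)] at hFy
    have h1 : (ρ ^ 2) ^ 2 ≤ ((R ^ 2 - 0 ^ 2) ^ 2) ^ 2 := by
      rw [zero_pow two_ne_zero, sub_zero]; gcongr
    have h2 : M * (u z * v z) ≤ M * (u y * v y) := by rw [hMP]; linarith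
    exact le_of_mul_le_mul_left h2 hMpos
  -- Clearing the denominator avoids differentiating a quotient: `ρ⁴ - MP` is nonpositive nearby and
  -- zero at `z`.
  have hmax : IsLocalMax
      (fun x => ((R ^ 2 - ‖x - y‖ ^ 2) ^ 2) ^ 2 - M * (u x * v x)) z := by
    have hn : ∀ᶠ x in nhds z, ‖x - y‖ < R := by
      have : Continuous fun x => ‖x - y‖ := by fun_prop
      exact this.continuousAt.eventually (gt_mem_nhds hz)
    filter_upwards [hn] with x hx
    have h1 := hle x hx.le
    rw [div_le_iff₀ (hP x)] at h1
    simp only [← hρdef]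
    linarith
  obtain ⟨g, h, hj, hsum⟩ := huv.hasJet_mul z
  have key := ((((HasJet.const (R ^ 2)).sub (HasJet.norm_sub_sq z y)).sq.sq).sub
    (hj.const_mul M)).nonpos_of_isLocalMax hmax
  simp only [← hρdef] at key
  have hg : ∑ i, (M * g i) ^ 2 = 64 * ρ ^ 6 * ‖z - y‖ ^ 2 := by
    rw [← EuclideanSpace.sum_sq_eq_norm_sq, Finset.mul_sum]
    refine Finset.sum_congr rfl fun i _ => ?_
    have : M * g i = -8 * ρ ^ 3 * (z - y) i := by linarith [(key i).1]
    rw [this]; ring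
  have hh : 48 * ρ ^ 2 * ‖z - y‖ ^ 2 - N * (8 * ρ ^ 3) ≤ M * ∑ i, h i := by
    calc 48 * ρ ^ 2 * ‖z - y‖ ^ 2 - N * (8 * ρ ^ 3)
        = ∑ i, (48 * ρ ^ 2 * (z - y) i ^ 2 - 8 * ρ ^ 3) := by
          rw [Finset.sum_sub_distrib, ← Finset.mul_sum, EuclideanSpace.sum_sq_eq_norm_sq]
          simp
      _ ≤ ∑ i, M * h i := Finset.sum_le_sum fun i _ => by linarith [(key i).2]
      _ = M * ∑ i, h i := by rw [Finset.mul_sum]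
  have hgM : M * ((∑ i, g i ^ 2) / (2 * (u z * v z))) = 32 * ρ ^ 2 * ‖z - y‖ ^ 2 := by
    have h1 : M ^ 2 * ∑ i, g i ^ 2 = 64 * ρ ^ 6 * ‖z - y‖ ^ 2 := by
      rw [← hg, Finset.mul_sum]
      simp only [mul_pow]
    have h2 : M * ((∑ i, g i ^ 2) / (2 * (u z * v z))) =
        (M ^ 2 * ∑ i, g i ^ 2) / (2 * (M * (u z * v z))) := by
      field_simp
    rw [h2, h1, hMP]
    field_simp
    ring
  have hS2 := two_mul_le_sq_add_sq (u := u) (v := v) z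
  set S := u z ^ 2 + v z ^ 2
  set P := u z * v z
  have hPα : 2 * (2 + α) * P < ω := by
    rw [lt_div_iff₀ (by positivity)] at hPzlt
    linarith
  -- Smallness of `P` lets `Sω` dominate `(2 + α)PS`, leaving `ΔP ≤ -2P + |∇P|²/(2P)`.
  have hbr : 2 * P ≤ 2 * P * (1 - S) + S * (ω - α * P) := by
    have h1 : 0 < S := by linarith
    have h2 : 0 ≤ S * (ω - (2 + α) * P) := mul_nonneg h1.le (by linarith [mul_pos (add_pos two_pos hα) hPz])
    linarith
  have hMsum : M * ∑ i, h i ≤ M * (-2 * P) + 32 * ρ ^ 2 * ‖z - y‖ ^ 2 := by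
    rw [← hgM, ← mul_add]
    refine mul_le_mul_of_nonneg_left ?_ hMpos.le
    linarith
  have hfin : 16 * ρ ^ 2 * ‖z - y‖ ^ 2 + 2 * ρ ^ 4 ≤ 8 * N * ρ ^ 3 := by
    have : M * (-2 * P) = -2 * ρ ^ 4 := by linear_combination (-2) * hMP
    linarith
  have hr2 : ‖z - y‖ ^ 2 = R ^ 2 - ρ := by rw [hρdef]; ring
  rw [hr2] at hfin
  have hneg : ρ ^ 2 * (ρ ^ 2 - 2 * R * ρ + 8 * R ^ 2) ≤ 0 := by
    have hN : 8 * (N : ℝ) = 4 * R - 16 := by rw [hR]; ring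
    rw [hN] at hfin
    linarith
  have : 0 < ρ ^ 2 * (ρ ^ 2 - 2 * R * ρ + 8 * R ^ 2) := by
    refine mul_pos (by positivity) ?_
    linarith [sq_nonneg (ρ - R), pow_pos hRpos 2, sub_sq ρ R]
  linarith

end IsPositiveRegularSolution

/-! ### Sharp bounds from almost extremal points. -/

theorem le_of_forall_pos_le_add_mul {A B K δ : ℝ} (hδ : 0 < δ)
    (h : ∀ η, 0 < η → η ≤ δ → A ≤ B + K * η) : A ≤ B := by
  by_contra! hlt
  have hK : 0 < |K| + 1 := by positivity
  have hpos : 0 < (A - B) / (2 * (|K| + 1)) := div_pos (by linarith) (by positivity)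
  have h1 := h (min δ ((A - B) / (2 * (|K| + 1)))) (lt_min hδ hpos) (min_le_left _ _)
  set η := min δ ((A - B) / (2 * (|K| + 1)))
  have h2 : η ≤ (A - B) / (2 * (|K| + 1)) := min_le_right _ _
  have h0 : 0 < η := lt_min hδ hpos
  rw [le_div_iff₀ (by positivity)] at h2
  have h3 : K * η ≤ |K| * η := by gcongr; exact le_abs_self K
  nlinarith

namespace IsPositiveRegularSolution

variable {N : ℕ} {α ω : ℝ} {u v : EuclideanSpace ℝ (Fin N) → ℝ}

/-- The inequality satisfied at an almost maximum point of `u² + v²`. -/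
theorem sup_mul_sub_one_le (huv : IsPositiveRegularSolution α ω u v) (hα : 0 < α) (hω : 0 < ω)
    {M m : ℝ} (hM : IsLUB (Set.range fun x => u x ^ 2 + v x ^ 2) M)
    (hm : ∀ x, m ≤ u x * v x) :
    M * (M - 1) ≤ 2 * (ω / α) * max (ω - α * m) 0 := by
  have hcu := huv.continuous_u
  have hcv := huv.continuous_v
  have hS : ∀ x, 0 < u x ^ 2 + v x ^ 2 := fun x => by have := huv.pos_u x; positivity
  have hle : ∀ x, u x ^ 2 + v x ^ 2 ≤ M := fun x => hM.1 ⟨x, rfl⟩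
  refine le_of_forall_pos_le_add_mul (K := N + 2 * M) one_pos fun η hη _ => ?_
  obtain ⟨_, ⟨y, rfl⟩, hy⟩ := (lt_isLUB_iff hM).mp (show M - η < M by linarith)
  obtain ⟨x, hx, hjet⟩ := exists_almost_max (f := fun x => u x ^ 2 + v x ^ 2) (by fun_prop)
    hle hη hy
  obtain ⟨g, h, hj, hsum⟩ := huv.hasJet_sq_add_sq x
  have hlap := (hjet g h hj).2
  have hgrad : 0 ≤ ∑ i, (fderiv ℝ u x (EuclideanSpace.single i 1) ^ 2 +
          fderiv ℝ v x (EuclideanSpace.single i 1) ^ 2) :=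
    Finset.sum_nonneg fun i _ => by positivity
  have hP : 0 < u x * v x := mul_pos (huv.pos_u x) (huv.pos_v x)
  have hSx := hS x
  have hSM := hle x
  have hmx := hm x
  set S := u x ^ 2 + v x ^ 2
  set P := u x * v x
  have hcross : P * (ω - α * P) ≤ ω / α * max (ω - α * m) 0 := by
    rcases le_total (ω - α * P) 0 with hn | hp
    · exact (mul_nonpos_of_nonneg_of_nonpos hP.le hn).trans (by positivity)
    · have h1 : P ≤ ω / α := by rw [le_div_iff₀ hα]; linarith
      have h2 : ω - α * P ≤ max (ω - α * m) 0 := le_max_of_le_left (by nlinarith)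
      gcongr
  have h1 : S * (S - 1) ≤ 2 * (ω / α) * max (ω - α * m) 0 + N * η := by linarith
  have h2 : (M - S) * (M + S - 1) ≤ η * (2 * M) := by
    rcases le_total (M + S - 1) 0 with hn | hp
    · exact (mul_nonpos_of_nonneg_of_nonpos (by linarith) hn).trans
        (mul_nonneg hη.le (by linarith))
    · exact mul_le_mul (by linarith) (by linarith) hp hη.le
  linarith

/-- The inequality satisfied at an almost minimum point of `u v`. -/
theorem sub_mul_inf_le (huv : IsPositiveRegularSolution α ω u v) (hα : 0 < α)
    {M m : ℝ} (hm : IsGLB (Set.range fun x => u x * v x) m)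
    (hM : ∀ x, u x ^ 2 + v x ^ 2 ≤ M) (hm0 : 0 < m) (hD : 0 < ω - α * m) :
    ω - α * m ≤ M - 1 := by
  have hcu := huv.continuous_u
  have hcv := huv.continuous_v
  have hle : ∀ x, m ≤ u x * v x := fun x => hm.1 ⟨x, rfl⟩
  -- The cap on `η` gives `η² ≤ η` and keeps `ω - αP ≥ 0`, so that `S ≥ 2P` can be multiplied by it.
  -- In `K`, `α` pays for replacing `P` by `m`, `N / m` for the Laplacian and `1 / m ^ 2` for the
  -- gradient.
  refine le_of_forall_pos_le_add_mul (K := α + N / m + 1 / m ^ 2)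
    (lt_min one_pos (div_pos hD hα)) fun η hη hηδ => ?_
  have hη1 : η ≤ 1 := hηδ.trans (min_le_left _ _)
  have hηD : α * η ≤ ω - α * m := by
    have := hηδ.trans (min_le_right _ _)
    rw [le_div_iff₀ hα] at this
    linarith
  obtain ⟨_, ⟨y, rfl⟩, hy⟩ := (isGLB_lt_iff hm).mp (show m < m + η by linarith)
  obtain ⟨x, hx, hjet⟩ := exists_almost_max (f := fun x => -1 * (u x * v x)) (M := -m)
    (by fun_prop) (fun x => by linarith [hle x]) hη (y := y) (by linarith)
  obtain ⟨g, h, hj, hsum⟩ := huv.hasJet_mul x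
  obtain ⟨h1, h2⟩ := hjet _ _ (hj.const_mul (-1))
  rw [← Finset.mul_sum] at h2
  have h1' : ∑ i, g i ^ 2 ≤ 4 * η ^ 2 := by
    simpa using h1
  have hmx := hle x
  have hMx := hM x
  have hS2 := two_mul_le_sq_add_sq (u := u) (v := v) x
  set S := u x ^ 2 + v x ^ 2
  set P := u x * v x
  have hP : 0 < P := hm0.trans_le hmx
  have hωP : ω - α * P = ω - α * m - α * (P - m) := by ring
  have hPm : α * (P - m) ≤ α * η := by gcongr; linarith
  have h3 : 2 * P * (ω - α * P) ≤ S * (ω - α * P) := by gcongr; linarith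
  have h4 : (∑ i, g i ^ 2) / (2 * P) ≤ 4 * η / (2 * m) := by
    gcongr
    nlinarith
  have h5 : 2 * P * (1 - S + (ω - α * P)) ≤ 2 * P * ((N / m + 1 / m ^ 2) * η) := by
    have h6 : 2 * m * ((N / m + 1 / m ^ 2) * η) = 2 * N * η + 4 * η / (2 * m) := by
      field_simp
      ring
    have h7 : 2 * m * ((N / m + 1 / m ^ 2) * η) ≤ 2 * P * ((N / m + 1 / m ^ 2) * η) := by
      gcongr
    linarith
  have h8 := le_of_mul_le_mul_left h5 (by positivity)
  linarith

/-- If `D = ω - αm > 0`, then `M(M - 1) ≤ 2(ω/α)D < D ≤ M - 1`, impossible since `M > 1`. -/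
theorem sq_add_sq_le_one_and_le_mul (huv : IsPositiveRegularSolution α ω u v) (hα : 0 < α)
    (hω : 0 < ω) (hωα : ω / α < 1 / 2) (x : EuclideanSpace ℝ (Fin N)) :
    u x ^ 2 + v x ^ 2 ≤ 1 ∧ ω / α ≤ u x * v x := by
  obtain ⟨M, hM⟩ := Real.exists_isLUB (s := Set.range fun x => u x ^ 2 + v x ^ 2)
    (Set.range_nonempty _)
    ⟨14 + 2 * N + ω ^ 2 / α, by rintro _ ⟨y, rfl⟩; exact huv.sq_add_sq_le hα y⟩
  have hlow : ω / (2 * (2 + α)) ∈ lowerBounds (Set.range fun x => u x * v x) := by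
    rintro _ ⟨y, rfl⟩; exact huv.le_mul hα hω y
  obtain ⟨m, hm⟩ := Real.exists_isGLB (s := Set.range fun x => u x * v x)
    (Set.range_nonempty _) ⟨_, hlow⟩
  have hMx : ∀ x, u x ^ 2 + v x ^ 2 ≤ M := fun x => hM.1 ⟨x, rfl⟩
  have hmx : ∀ x, m ≤ u x * v x := fun x => hm.1 ⟨x, rfl⟩
  have hm0 : 0 < m := lt_of_lt_of_le (by positivity) (hm.2 hlow)
  have hM0 : 0 < M := by linarith [hMx x, hmx x, two_mul_le_sq_add_sq (u := u) (v := v) x]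
  have h1 := huv.sup_mul_sub_one_le hα hω hM hmx
  have hD : ω - α * m ≤ 0 := by
    by_contra! hD
    have h2 := huv.sub_mul_inf_le hα hm hMx hm0 hD
    rw [max_eq_left hD.le] at h1
    have h3 : 2 * (ω / α) * (ω - α * m) < 1 * (ω - α * m) := by gcongr; linarith
    nlinarith
  rw [max_eq_right hD, mul_zero] at h1
  have hM1 : M ≤ 1 := by
    by_contra! h
    nlinarith
  refine ⟨(hMx x).trans hM1, le_trans ?_ (hmx x)⟩
  rw [div_le_iff₀ hα]
  linarith

/-! ### Rigidity. -/

/-- If `u² + v²` reaches `1`, then the solution is constant. -/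
theorem eq_of_sq_add_sq_eq_one (huv : IsPositiveRegularSolution α ω u v) (hα : 0 < α)
    (hω : 0 < ω) (hωα : ω / α < 1 / 2) {x₀ : EuclideanSpace ℝ (Fin N)}
    (h0 : u x₀ ^ 2 + v x₀ ^ 2 = 1) (x : EuclideanSpace ℝ (Fin N)) :
    u x = u x₀ ∧ v x = v x₀ ∧ u x₀ * v x₀ = ω / α := by
  have hcu := huv.continuous_u
  have hcv := huv.continuous_v
  have hb := huv.sq_add_sq_le_one_and_le_mul hα hω hωα
  have hcross : ∀ x, 0 ≤ u x * v x * (α * (u x * v x) - ω) := fun x => by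
    refine mul_nonneg (mul_pos (huv.pos_u x) (huv.pos_v x)).le ?_
    have := (hb x).2
    rw [div_le_iff₀ hα] at this
    linarith
  have hgrad : ∀ x, 0 ≤ ∑ i, (fderiv ℝ u x (EuclideanSpace.single i 1) ^ 2 +
          fderiv ℝ v x (EuclideanSpace.single i 1) ^ 2) := fun x =>
    Finset.sum_nonneg fun i _ => by positivity
  -- `Δ(1 - S) ≤ 2S(1 - S) ≤ 2(1 - S)`, because `0 ≤ S ≤ 1` and `αP ≥ ω`.
  have hone : ∀ x, 1 - (u x ^ 2 + v x ^ 2) = 0 := by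
    refine eq_zero_of_laplacian_le (C := 2) (by fun_prop) two_pos
      (fun x => by linarith [(hb x).1]) (fun x => ?_) (x₀ := x₀) (by linarith)
    obtain ⟨g, h, hj, hsum⟩ := huv.hasJet_sq_add_sq x
    refine ⟨_, _, (HasJet.const 1).sub hj, ?_⟩
    simp only [zero_sub, Finset.sum_neg_distrib]
    rw [hsum]
    nlinarith [hcross x, hgrad x, (hb x).1]
  have hzero : ∀ x, ∑ i, (fderiv ℝ u x (EuclideanSpace.single i 1) ^ 2 +
      fderiv ℝ v x (EuclideanSpace.single i 1) ^ 2) = 0 ∧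
      u x * v x * (α * (u x * v x) - ω) = 0 := fun x => by
    obtain ⟨g, h, hj, hsum⟩ := huv.hasJet_sq_add_sq x
    have hfun : (fun y => u y ^ 2 + v y ^ 2) = fun _ => 1 := by
      funext y; linarith [hone y]
    have hS : u x ^ 2 + v x ^ 2 = 1 := by linarith [hone x]
    have hmax : IsLocalMax (fun y => u y ^ 2 + v y ^ 2) x := by
      rw [hfun]; exact Filter.Eventually.of_forall fun _ => le_rfl
    have : ∑ i, h i ≤ 0 :=
      Finset.sum_nonpos fun i _ => (hj.nonpos_of_isLocalMax hmax i).2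
    rw [hsum, hS] at this
    constructor <;> linarith [hcross x, hgrad x]
  have hext : ∀ L : EuclideanSpace ℝ (Fin N) →L[ℝ] ℝ,
      (∀ i, L (EuclideanSpace.single i 1) = 0) → L = 0 := fun L hL => by
    have : L.toLinearMap = 0 :=
      (EuclideanSpace.basisFun (Fin N) ℝ).toBasis.ext fun i => by simpa using hL i
    ext y
    exact LinearMap.congr_fun this y
  have hpart : ∀ x i, fderiv ℝ u x (EuclideanSpace.single i 1) = 0 ∧
      fderiv ℝ v x (EuclideanSpace.single i 1) = 0 := fun x i => by
    have h1 := (Finset.sum_eq_zero_iff_of_nonneg (fun i _ => by positivity)).mp (hzero x).1 i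
      (Finset.mem_univ i)
    constructor <;> nlinarith [sq_nonneg (fderiv ℝ u x (EuclideanSpace.single i 1)),
      sq_nonneg (fderiv ℝ v x (EuclideanSpace.single i 1))]
  refine ⟨?_, ?_, ?_⟩
  · exact is_const_of_fderiv_eq_zero (𝕜 := ℝ) (huv.contDiff_u.differentiable (by norm_num))
      (fun x => hext _ fun i => (hpart x i).1) x x₀
  · exact is_const_of_fderiv_eq_zero (𝕜 := ℝ) (huv.contDiff_v.differentiable (by norm_num))
      (fun x => hext _ fun i => (hpart x i).2) x x₀
  · rcases mul_eq_zero.mp (hzero x₀).2 with h | h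
    · exact absurd h (mul_pos (huv.pos_u x₀) (huv.pos_v x₀)).ne'
    · rw [eq_div_iff hα.ne']; linarith

end IsPositiveRegularSolution

/-! ### Algebra of the constant states. -/

namespace IsConstantState

variable {α ω a b p q : ℝ}

/-- Pairs of positive reals in the admissible region and inside the unit circle lie strictly between
`a` and `b`. -/
theorem lt_and_lt (hab : IsConstantState α ω a b) (hp : 0 < p)
    (hS : p ^ 2 + q ^ 2 < 1) (hP : ω / α ≤ p * q) : a < p ∧ p < b := by
  have ha := hab.pos
  have hlt := hab.lt
  have hsum := hab.sq_add_sq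
  have hb : 0 < b := ha.trans hlt
  rw [← hab.mul_eq] at hP
  have h1 : (a * b) ^ 2 ≤ (p * q) ^ 2 := by gcongr
  have h2 : p ^ 2 * q ^ 2 < p ^ 2 * (1 - p ^ 2) := by gcongr; linarith
  -- `a²` and `b²` are the roots of `t² - t + (ab)²`, which is negative at `t = p²`.
  have h3 : (p ^ 2 - a ^ 2) * (p ^ 2 - b ^ 2) < 0 := by
    have : (p ^ 2 - a ^ 2) * (p ^ 2 - b ^ 2) =
        (a * b) ^ 2 - p ^ 2 * ((a ^ 2 + b ^ 2) - p ^ 2) := by ring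
    rw [this, hsum]
    linarith [mul_pow p q 2]
  have h4 : a ^ 2 < b ^ 2 := by gcongr
  constructor
  · by_contra! h
    have : p ^ 2 ≤ a ^ 2 := by gcongr
    nlinarith
  · by_contra! h
    have : b ^ 2 ≤ p ^ 2 := by gcongr
    nlinarith

/-- The only positive solutions of the algebraic system are `(a, b)` and `(b, a)`. -/
theorem eq_or_eq (hab : IsConstantState α ω a b) (hp : 0 < p) (hq : 0 < q)
    (hS : p ^ 2 + q ^ 2 = 1) (hP : p * q = ω / α) : p = a ∧ q = b ∨ p = b ∧ q = a := by
  have ha := hab.pos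
  have hb : 0 < b := ha.trans hab.lt
  have hsum : p + q = a + b := by
    refine (sq_eq_sq₀ (by positivity) (by positivity)).mp ?_
    linarith [hab.sq_add_sq, hab.mul_eq, add_sq p q, add_sq a b]
  have h : (p - a) * (p - b) = 0 := by
    have := hab.mul_eq
    linear_combination p * hsum - hP + this
  rcases mul_eq_zero.mp h with h | h
  · left; constructor <;> linarith
  · right; constructor <;> linarith

end IsConstantState

theorem proposition1p2 {N : ℕ} (α ω : ℝ) (hα : 0 < α) (hω : 0 < ω) (hωα : ω / α < 1 / 2)
    (u v : EuclideanSpace ℝ (Fin N) → ℝ) (huv : IsPositiveRegularSolution α ω u v) :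
    (∀ x, u x ^ 2 + v x ^ 2 ≤ 1 ∧ ω / α ≤ u x * v x) ∧
    ∀ a b : ℝ, IsConstantState α ω a b →
      ((∀ x, u x = a ∧ v x = b) ∨
       (∀ x, u x = b ∧ v x = a) ∨
       (∀ x, (a < u x ∧ u x < b) ∧ (a < v x ∧ v x < b))) := by
  have hbound := huv.sq_add_sq_le_one_and_le_mul hα hω hωα
  refine ⟨hbound, fun a b hab => ?_⟩
  by_cases hex : ∃ x₀, u x₀ ^ 2 + v x₀ ^ 2 = 1
  · obtain ⟨x₀, h0⟩ := hex
    have hconst := huv.eq_of_sq_add_sq_eq_one hα hω hωα h0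
    rcases hab.eq_or_eq (huv.pos_u x₀) (huv.pos_v x₀) h0 (hconst x₀).2.2 with ⟨h1, h2⟩ | ⟨h1, h2⟩
    · exact Or.inl fun x => ⟨(hconst x).1.trans h1, (hconst x).2.1.trans h2⟩
    · exact Or.inr (Or.inl fun x => ⟨(hconst x).1.trans h1, (hconst x).2.1.trans h2⟩)
  · push Not at hex
    refine Or.inr (Or.inr fun x => ?_)
    have hlt := lt_of_le_of_ne (hbound x).1 (hex x)
    exact ⟨hab.lt_and_lt (huv.pos_u x) hlt (hbound x).2,
      hab.lt_and_lt (q := u x) (huv.pos_v x) (by linarith)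
        (by rw [mul_comm]; exact (hbound x).2)⟩
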